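/- Throughout, matroids may be infinite: a matroid on a set $E$ is a pair $(E,\mathcal I)$ with $\mathcal I\subseteq\mathcal P(E)$ (the independent sets) such that (1) $\varnothing\in\mathcal I$; (2) $\mathcal I$ is closed under taking subsets; (3) if $I,J\in\mathcal I$, where $J$ is $\subseteq$-maximal in $\mathcal I$ and $I$ is not, then $I\cup\{e\}\in\mathcal I$ for some $e\in J\setminus I$; (4) for every $X\subseteq E$, every $I\in\mathcal I$ with $I\subseteq X$ extends to a $\subseteq$-maximal element of $\mathcal I\cap\mathcal P(X)$. The circuits are the minimal non-independent subsets of $E$, the bases are the maximal independent sets, and the dual $M^*$ is the matroid on $E$ whose bases are the complements of the bases of $M$. A set $X\subseteq E$ spans $e\in E$ in $M$ if $e\in X$ or there is a circuit $C\ni e$ with $C\setminus\{e\}\subseteq X$; it spans $Y\subseteq E$ if it spans every element of $Y$. A matroid is finitary if all its circuits are finite, and cofinitary if its dual is finitary. The direct sum of matroids on disjoint sets $E_0$ and $E_1$ is the matroid on $E_0\sqcup E_1$ whose independent sets are the sets $I_0\cup I_1$ with $I_i$ independent in the $i$-th matroid; $E_0$ or $E_1$ may be empty. **Theorem 1.2.**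 Let $M$ and $N$ be matroids on the same countable edge set $E$, each of which is the direct sum of a finitary matroid and a cofinitary matroid. Then there are a set $I\subseteq E$ that is independent in both $M$ and $N$ and a partition $E=E_M\sqcup E_N$ (parts may be empty) such that $I\cap E_M$ spans $E_M$ in $M$ and $I\cap E_N$ spans $E_N$ in $N$. -/

import Mathlib

namespace Matroid

/-- A matroid is cofinitary if its dual is finitary, i.e. if all its cocircuits are finite. -/
def IsCofinitary {α : Type*} (M : Matroid α) : Prop :=
  M✶.Finitary

/-- The class `𝔉 ⊕ 𝔉*`: `M` is the direct sum of a finitary matroid `F` and a cofinitary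
matroid `C` on disjoint ground sets (either of which may be empty). -/
def IsFinitarySumCofinitary {α : Type*} (M : Matroid α) : Prop :=
  ∃ (F C : Matroid α) (h : Disjoint F.E C.E),
    F.Finitary ∧ C.IsCofinitary ∧ M = F.disjointSum C h

end Matroid

/-!
Call `W` a wave for `(M, N)` if some subset of `W` spans `W` in `M` and stays independent in `N`
after contracting the complement of `W`; the theorem asks for a partition of `E` into a wave for
`(M, N)` and a wave for `(N, M)`. Waves are closed under unions, so there is a largest one, and
contracting it in `M` and deleting it in `N` leaves a pair without nonempty waves.

For such a pair of finitary matroids, a common independent set is *nice* if contracting it leaves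
only trivial waves. Augment nice sets repeatedly along alternating paths, always starting from the
first augmentable element in an enumeration of `E`. The elements that are never spanned in `N`,
together with all that can be reached from them, form a wave because `N` is finitary; as this wave
is trivial, any prescribed element eventually gets spanned. Restarting from the resulting nice set
for one element after the other gives an increasing sequence whose union is independent, because
`M` is finitary, and spans `N`.

Now let `N = F ⊕ C` with `F` finitary and `C` cofinitary. Make `M` and `C✶` act on disjoint copies
of the ground set, and let the second matroid be `F` on the first copy together with one parallel
pair `{e, e'}` for every `e ∈ C.E`. This matroid is finitary, and a solution for the new pair
restricts to one for `(M, N)`: being disjoint from an independent subset of `C✶` encodes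
independence in `C`. Applying this first to `N` and then to `M` reduces to two finitary matroids.
-/

namespace MatroidIntersection

open Matroid

variable {α : Type*} {M N : Matroid α}

section Contract

variable {B B' D I X Y : Set α}

lemma contract_indep_iff_forall_notMem_closure :
    (N ／ X).Indep B ↔ B ⊆ N.E ∧ ∀ b ∈ B, b ∉ N.closure (X ∪ B \ {b}) := by
  rw [indep_iff_forall_notMem_closure_sdiff']
  simp only [contract_ground, contract_closure_eq, Set.subset_sdiff, Set.mem_sdiff,
    Set.union_comm X]
  refine ⟨fun ⟨hB, h⟩ ↦ ⟨hB.1, fun b hb hcl ↦ h b hb ⟨hcl, hB.2.notMem_of_mem_left hb⟩⟩,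
    fun ⟨hB, h⟩ ↦ ⟨⟨hB, Set.disjoint_left.2 fun b hb hbX ↦ h b hb ?_⟩, fun b hb hcl ↦ h b hb hcl.1⟩⟩
  exact N.mem_closure_of_mem' (Or.inr hbX) (hB hb)

lemma contract_indep_of_subset_closure (h : (N ／ X).Indep B) (hY : Y ⊆ N.closure X) :
    (N ／ Y).Indep B := by
  rw [contract_indep_iff_forall_notMem_closure] at h ⊢
  refine ⟨h.1, fun b hb hcl ↦ h.2 b hb ?_⟩
  rw [← closure_union_closure_left_eq]
  exact N.closure_subset_closure (Set.union_subset_union_left _ hY) hcl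

lemma contract_indep_of_subset (h : (N ／ X).Indep B) (hYX : Y ⊆ X) : (N ／ Y).Indep B := by
  rw [contract_indep_iff_forall_notMem_closure] at h ⊢
  exact ⟨h.1, fun b hb hcl ↦
    h.2 b hb (N.closure_subset_closure (Set.union_subset_union_left _ hYX) hcl)⟩

lemma contract_indep_notMem_closure (h : (N ／ X).Indep B) {b : α} (hb : b ∈ B) :
    b ∉ N.closure X :=
  fun hcl ↦ (contract_indep_iff_forall_notMem_closure.1 h).2 b hb
    (N.closure_subset_closure Set.subset_union_left hcl)

lemma union_indep_of_contract_indep (hB : (N ／ X).Indep B) (hB' : N.Indep B') (h : B' ⊆ X) :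
    N.Indep (B ∪ B') :=
  (hB'.contract_indep_iff.1 (contract_indep_of_subset hB h)).2

lemma contract_union_indep (hB : (N ／ Y).Indep B) (hB' : (N ／ X).Indep B') (hX : X ⊆ Y)
    (hBY : B' ⊆ Y) : (N ／ X).Indep (B ∪ B') := by
  refine union_indep_of_contract_indep (X := Y) ?_ hB' hBY
  rwa [contract_contract, Set.union_eq_self_of_subset_left hX]

lemma sdiff_indep_contract_of_inter_subset_closure (hI : N.Indep I)
    (hD : D ∩ N.E ⊆ N.closure (I ∩ D)) : (N ／ D).Indep (I \ D) := by
  have h : (N ／ (I ∩ D)).Indep (I \ D) := by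
    rw [(hI.subset Set.inter_subset_left).contract_indep_iff, Set.sdiff_union_inter]
    exact ⟨Set.disjoint_left.2 (fun x hx hx' ↦ hx.2 hx'.2), hI⟩
  rw [← contract_inter_ground_eq]
  exact contract_indep_of_subset_closure h hD

end Contract

section Wave

variable {B V W X : Set α}

/-- `W` is a wave for `(M, N)`: some subset of `W` spans `W` in `M` and stays independent in the
minor of `N` obtained by contracting the complement of `W`. -/
def IsWave (M N : Matroid α) (W : Set α) : Prop :=
  ∃ B ⊆ W, W ⊆ M.closure B ∧ (N ／ (N.E \ W)).Indep B

lemma iUnion_subset_closure_iUnion_sdiff {ι : Type*} [LinearOrder ι] [WellFoundedLT ι]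
    {f W : ι → Set α} (hf : ∀ i, f i ⊆ W i) (hW : ∀ i, W i ⊆ M.closure (f i)) :
    ⋃ i, W i ⊆ M.closure (⋃ i, f i \ ⋃ j < i, W j) := by
  refine Set.iUnion_subset fun i ↦ ?_
  induction i using WellFoundedLT.induction with
  | ind i ih =>
    refine (hW i).trans (M.closure_subset_closure_of_subset_closure fun x hx ↦ ?_)
    by_cases hxj : x ∈ ⋃ j < i, W j
    · obtain ⟨j, hj, hxj⟩ := Set.mem_iUnion₂.1 hxj
      exact ih j hj hxj
    · exact M.mem_closure_of_mem' (Set.mem_iUnion.2 ⟨i, hx, hxj⟩)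
        (mem_ground_of_mem_closure (hW i (hf i hx)))

/-- A circuit violating independence would, with `i` the least index for which it meets `W i`, meet
`W i` only in `f i`. -/
lemma contract_indep_iUnion_sdiff {ι : Type*} [LinearOrder ι] [WellFoundedLT ι]
    {f W : ι → Set α} (hf : ∀ i, f i ⊆ W i) (hN : ∀ i, (N ／ (N.E \ W i)).Indep (f i)) :
    (N ／ (N.E \ ⋃ i, W i)).Indep (⋃ i, f i \ ⋃ j < i, W j) := by
  refine contract_indep_iff_forall_notMem_closure.2 ⟨Set.iUnion_subset fun i ↦
    Set.sdiff_subset.trans (contract_indep_iff_forall_notMem_closure.1 (hN i)).1, fun b hb hcl ↦ ?_⟩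
  obtain ⟨i₀, hbi₀⟩ := Set.mem_iUnion.1 hb
  have hbW : b ∈ W i₀ := hf i₀ hbi₀.1
  have hb_notMem : b ∉ (N.E \ ⋃ i, W i) ∪ (⋃ i, f i \ ⋃ j < i, W j) \ {b} := by
    rintro (h | h)
    exacts [h.2 (Set.mem_iUnion.2 ⟨i₀, hbW⟩), h.2 rfl]
  obtain ⟨C, hCsub, hC, hbC⟩ := exists_isCircuit_of_mem_closure hcl hb_notMem
  obtain ⟨i, ⟨c, hcC, hci⟩, hmin⟩ :=
    WellFounded.has_min wellFounded_lt {i | (C ∩ W i).Nonempty} ⟨i₀, b, hbC, hbW⟩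
  have hCW : C ∩ W i ⊆ f i := by
    rintro x ⟨hxC, hxi⟩
    have hxB : x ∈ ⋃ i, f i \ ⋃ j < i, W j := by
      rcases hCsub hxC with rfl | hx | hx
      exacts [hb, (hx.2 (Set.mem_iUnion.2 ⟨i, hxi⟩)).elim, hx.1]
    obtain ⟨j, hxj, hxlt⟩ := Set.mem_iUnion.1 hxB
    have hij : ¬ i < j := fun h ↦ hxlt (Set.mem_iUnion₂.2 ⟨i, h, hxi⟩)
    rwa [(not_lt.1 (hmin j ⟨x, hxC, hf j hxj⟩)).antisymm (not_lt.1 hij)]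
  refine (contract_indep_iff_forall_notMem_closure.1 (hN i)).2 c (hCW ⟨hcC, hci⟩)
    (N.closure_subset_closure ?_ (hC.mem_closure_sdiff_singleton_of_mem hcC))
  rintro x ⟨hxC, hxc⟩
  by_cases hxi : x ∈ W i
  exacts [Or.inr ⟨hCW ⟨hxC, hxi⟩, hxc⟩, Or.inl ⟨hC.subset_ground hxC, hxi⟩]

lemma IsWave.iUnion {ι : Type*} {W : ι → Set α} (hW : ∀ i, IsWave M N (W i)) :
    IsWave M N (⋃ i, W i) := by
  obtain ⟨_, _⟩ := exists_wellFoundedLT ι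
  choose f hfW hfM hfN using hW
  exact ⟨⋃ i, f i \ ⋃ j < i, W j, Set.iUnion_mono fun i ↦ Set.sdiff_subset.trans (hfW i),
    iUnion_subset_closure_iUnion_sdiff hfW hfM, contract_indep_iUnion_sdiff hfW hfN⟩

lemma IsWave.subset_ground (hW : IsWave M N W) : W ⊆ M.E :=
  hW.choose_spec.2.1.trans (M.closure_subset_ground _)

lemma IsWave.union (hW : IsWave M N W) (hBV : B ⊆ V) (hM : V ⊆ M.closure (W ∪ B))
    (hN : (N ／ (N.E \ (W ∪ V))).Indep B) : IsWave M N (W ∪ V) := by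
  obtain ⟨A, hAW, hAM, hAN⟩ := hW
  have hWB : W ∪ B ⊆ M.closure (A ∪ B \ W) := by
    refine Set.union_subset (hAM.trans (M.closure_subset_closure Set.subset_union_left))
      fun x hx ↦ ?_
    by_cases hxW : x ∈ W
    · exact M.closure_subset_closure Set.subset_union_left (hAM hxW)
    · exact M.mem_closure_of_mem' (Or.inr ⟨hx, hxW⟩) (mem_ground_of_mem_closure (hM (hBV hx)))
  refine ⟨A ∪ B \ W, Set.union_subset_union hAW (Set.sdiff_subset.trans hBV), ?_, ?_⟩
  · exact Set.union_subset (Set.subset_union_left.trans hWB)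
      (hM.trans (closure_subset_closure_of_subset_closure hWB))
  · exact contract_union_indep hAN (hN.subset Set.sdiff_subset)
      (Set.sdiff_subset_sdiff_right Set.subset_union_left)
      (Set.sdiff_subset_sdiff_left hN.of_contract.subset_ground)

lemma IsWave.of_restrict_contract (hXM : X ⊆ M.E) (hXN : X ⊆ N.E)
    (hW : IsWave (M ↾ X) (N ／ (N.E \ X)) W) :
    IsWave M N W := by
  have hWX : W ⊆ X := hW.subset_ground
  obtain ⟨B, hBW, hM, hN⟩ := hW
  refine ⟨B, hBW, ?_, ?_⟩
  · rw [M.restrict_closure_eq (hBW.trans hWX)] at hM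
    exact hM.trans Set.inter_subset_left
  · rw [contract_contract, contract_ground, Set.sdiff_sdiff_cancel_left hXN] at hN
    rwa [Set.sdiff_union_sdiff_cancel hXN hWX] at hN

/-- The union of all waves for `(M, N)`, itself a wave. -/
def maxWave (M N : Matroid α) : Set α := ⋃₀ {W | IsWave M N W}

lemma IsWave.subset_maxWave (hW : IsWave M N W) : W ⊆ maxWave M N :=
  Set.subset_sUnion_of_mem hW

lemma isWave_maxWave : IsWave M N (maxWave M N) := by
  rw [maxWave, Set.sUnion_eq_iUnion]
  exact .iUnion Subtype.prop

lemma exists_indep_closure_eq_maxWave (M N : Matroid α) :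
    ∃ B, M.Indep B ∧ M.closure B = maxWave M N ∧ (N ／ (N.E \ maxWave M N)).Indep B := by
  obtain ⟨A, -, hAM, hAN⟩ := isWave_maxWave (M := M) (N := N)
  obtain ⟨B, hB⟩ := M.exists_isBasis' A
  have hBN := hAN.subset hB.subset
  have hcl : maxWave M N ⊆ M.closure B := hB.closure_eq_closure ▸ hAM
  have hwave : IsWave M N (M.closure B) := ⟨B, M.subset_closure B hB.indep.subset_ground,
    subset_rfl, contract_indep_of_subset hBN (Set.sdiff_subset_sdiff_right hcl)⟩
  exact ⟨B, hB.indep, hwave.subset_maxWave.antisymm hcl, hBN⟩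

lemma IsWave.subset_maxWave_of_contract (hB : B ⊆ maxWave M N)
    (hW : IsWave (M ／ B) (N ／ B) W) : W ⊆ maxWave M N := by
  obtain ⟨A, hAW, hM, hN⟩ := hW
  refine Set.subset_union_right.trans (isWave_maxWave.union hAW ?_ ?_).subset_maxWave
  · rw [contract_closure_eq, Set.union_comm] at hM
    exact (hM.trans Set.sdiff_subset).trans
      (M.closure_subset_closure (Set.union_subset_union_left _ hB))
  · rw [contract_contract, contract_ground] at hN
    refine contract_indep_of_subset hN fun x ⟨hx, hxW⟩ ↦ Or.inr ⟨⟨hx, fun h ↦ ?_⟩, fun h ↦ ?_⟩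
    exacts [hxW (Or.inl (hB h)), hxW (Or.inr h)]

/-- The condition under which augmentation succeeds: every wave for `(M, N)` consists of loops of
`M`, and the nonloops of `M` span `N`. -/
structure TrivialWaves (M N : Matroid α) : Prop where
  subset_loops : ∀ ⦃W⦄, IsWave M N W → W ⊆ M.loops
  subset_closure : N.E ⊆ N.closure (N.E \ M.loops)

end Wave

section Intersection

/-- The conclusion of the Matroid Intersection Conjecture, with both spanning conditions phrased
as waves: a wave for `(M, N)` and a wave for `(N, M)` partition the ground set. -/
def HasIntersection (M N : Matroid α) : Prop :=
  ∃ A, IsWave M N A ∧ IsWave N M (M.E \ A)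

lemma HasIntersection.symm (h : HasIntersection M N) (hE : M.E = N.E) : HasIntersection N M := by
  obtain ⟨A, hA, hD⟩ := h
  exact ⟨M.E \ A, hD, by rwa [← hE, Set.sdiff_sdiff_cancel_left hA.subset_ground]⟩

lemma HasIntersection.exists_common_indep (h : HasIntersection M N) (hE : M.E = N.E) :
    ∃ I, M.Indep I ∧ N.Indep I ∧ ∃ A D, A ∪ D = M.E ∧ Disjoint A D ∧
      A ⊆ M.closure (I ∩ A) ∧ D ⊆ N.closure (I ∩ D) := by
  obtain ⟨A, hA, J, hJD, hJ, hJM⟩ := h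
  have hAE := hA.subset_ground
  obtain ⟨I, hIA, hI, hIN⟩ := hA
  rw [Set.sdiff_sdiff_cancel_left hAE] at hJM
  rw [← hE] at hIN
  obtain ⟨I', hI'⟩ := M.exists_isBasis' I
  obtain ⟨J', hJ'⟩ := N.exists_isBasis' J
  have hI'A := hI'.subset.trans hIA
  have hJ'D := hJ'.subset.trans hJD
  refine ⟨I' ∪ J', ?_, union_indep_of_contract_indep (hIN.subset hI'.subset) hJ'.indep hJ'D,
    A, M.E \ A, Set.union_sdiff_cancel hAE, Set.disjoint_sdiff_right, ?_, ?_⟩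
  · rw [Set.union_comm]
    exact union_indep_of_contract_indep (hJM.subset hJ'.subset) hI'.indep hI'A
  · rw [← hI'.closure_eq_closure] at hI
    exact hI.trans (M.closure_subset_closure (Set.subset_inter Set.subset_union_left hI'A))
  · rw [← hJ'.closure_eq_closure] at hJ
    exact hJ.trans (N.closure_subset_closure (Set.subset_inter Set.subset_union_right hJ'D))

lemma HasIntersection.exists_isFlat (h : HasIntersection M N) (hE : M.E = N.E) :
    ∃ D I J, N.IsFlat D ∧ I ⊆ M.E \ D ∧ J ⊆ D ∧ M.E \ D ⊆ M.closure I ∧ D ⊆ N.closure J ∧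
      (N ／ D).Indep I ∧ (M ／ (M.E \ D)).Indep J := by
  obtain ⟨A, hA, J, hJA, hJ, hJM⟩ := h
  have hAE := hA.subset_ground
  obtain ⟨I, hIA, hI, hIN⟩ := hA
  rw [Set.sdiff_sdiff_cancel_left hAE] at hJM
  rw [← hE] at hIN
  have hJcl : J ⊆ N.closure J :=
    N.subset_closure J (hE ▸ hJA.trans Set.sdiff_subset)
  have hcl : M.E \ N.closure J ⊆ A := fun x hx ↦ by_contra fun hxA ↦ hx.2 (hJ ⟨hx.1, hxA⟩)
  have hIcl := contract_indep_of_subset_closure hIN (N.closure_subset_closure hJA)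
  refine ⟨N.closure J, I, J, N.isFlat_closure J, fun x hx ↦ ⟨hAE (hIA hx), fun hxJ ↦ ?_⟩, hJcl,
    hcl.trans hI, subset_rfl, hIcl, contract_indep_of_subset hJM hcl⟩
  exact contract_indep_notMem_closure hIN hx (N.closure_subset_closure hJA hxJ)

end Intersection

section Exchange

variable {I J K X Y Z : Set α} {x x' y y' z : α}

/-- Exchanging `y ∈ I` for `x` keeps the closure of `I`: for an independent `I` this means that
`y` lies in the fundamental circuit of `x`, or that `x = y`. -/
def Exchanges (M : Matroid α) (I : Set α) (x y : α) : Prop :=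
  x ∈ M.closure I ∧ y ∈ I ∧ x ∉ M.closure (I \ {y})

lemma exchanges_self (hI : M.Indep I) (hy : y ∈ I) : Exchanges M I y y :=
  ⟨M.mem_closure_of_mem hy hI.subset_ground, hy, hI.notMem_closure_sdiff_of_mem hy⟩

lemma Exchanges.closure_eq (h : Exchanges M I x y) :
    M.closure (insert x (I \ {y})) = M.closure I := by
  have hI := Set.insert_sdiff_self_of_mem h.2.1
  rw [M.closure_insert_congr (f := y) ⟨by rw [hI]; exact h.1, h.2.2⟩, hI]

lemma exchanges_congr_of_subset (hI : M.Indep I) (hK : K ⊆ I) (hx : x ∈ M.closure K) :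
    Exchanges M K x y ↔ Exchanges M I x y := by
  constructor
  · rintro ⟨-, hy, hxy⟩
    refine ⟨M.closure_subset_closure hK hx, hK hy, fun h ↦ hxy ?_⟩
    have hinter : K \ {y} = (I \ {y}) ∩ K := by
      rw [Set.inter_comm, ← Set.inter_sdiff_assoc, Set.inter_eq_self_of_subset_left hK]
    rw [hinter,
      (hI.subset (Set.union_subset Set.sdiff_subset hK)).closure_inter_eq_inter_closure]
    exact ⟨h, hx⟩
  · rintro ⟨-, -, hxy⟩
    refine ⟨hx, by_contra fun hyK ↦ hxy ?_, fun h ↦ hxy ?_⟩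
    · exact M.closure_subset_closure (Set.subset_sdiff_singleton hK hyK) hx
    · exact M.closure_subset_closure (Set.sdiff_subset_sdiff_left hK) h

lemma mem_closure_of_forall_exchanges_mem (hI : M.Indep I) (hJI : J ⊆ I)
    (hx : x ∈ M.closure I) (h : ∀ y, Exchanges M I x y → y ∈ J) : x ∈ M.closure J := by
  obtain hIJ | hne := (I \ J).eq_empty_or_nonempty
  · rwa [hJI.antisymm (Set.sdiff_eq_empty.1 hIJ)]
  have hJ : J = ⋂ y ∈ I \ J, I \ {y} := by
    ext a
    simp only [Set.mem_iInter₂, Set.mem_sdiff, Set.mem_singleton_iff]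
    refine ⟨fun ha y hy ↦ ⟨hJI ha, fun hay ↦ hy.2 (hay ▸ ha)⟩, fun ha ↦ by_contra fun haJ ↦ ?_⟩
    obtain ⟨y, hy⟩ := hne
    exact (ha a ⟨(ha y hy).1, haJ⟩).2 rfl
  rw [hJ, closure_biInter_eq_biInter_closure_of_biUnion_indep hne (I := fun y ↦ I \ {y})
    (hI.subset (Set.iUnion₂_subset fun _ _ ↦ Set.sdiff_subset)), Set.mem_iInter₂]
  exact fun y hy ↦ by_contra fun hxy ↦ hy.2 (h y ⟨hx, hy.1, hxy⟩)

lemma exchanges_insert_sdiff_iff (hzy : Exchanges N I z y) (hy' : y' ∈ I)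
    (hzy' : ¬ Exchanges N I z y') :
    Exchanges N (insert z (I \ {y})) x y' ↔ Exchanges N I x y' := by
  have hne : y' ≠ y := by rintro rfl; exact hzy' hzy
  have hne' : z ≠ y' := by
    rintro rfl
    exact hzy.2.2 (N.mem_closure_of_mem' ⟨hy', hne⟩ (mem_ground_of_mem_closure hzy.1))
  have hzI : Exchanges N (I \ {y'}) z y :=
    ⟨by_contra fun h ↦ hzy' ⟨hzy.1, hy', h⟩, ⟨hzy.2.1, hne.symm⟩, fun h ↦ hzy.2.2
      (N.closure_subset_closure (Set.sdiff_subset_sdiff_left Set.sdiff_subset) h)⟩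
  have hswap : insert z (I \ {y}) \ {y'} = insert z ((I \ {y'}) \ {y}) := by
    rw [← Set.insert_sdiff_singleton_comm hne', Set.sdiff_sdiff_comm]
  simp only [Exchanges, hswap, hzy.closure_eq, hzI.closure_eq, Set.mem_insert_iff,
    Set.mem_sdiff, hy', hne'.symm, Set.mem_singleton_iff, hne, not_false_eq_true, and_self,
    or_true]

/-- Two consecutive arcs `x → y → x'` of the exchange digraph of a common independent set. -/
def ExchangeStep (M N : Matroid α) (I : Set α) (x x' : α) : Prop :=
  ∃ y, Exchanges M I x y ∧ Exchanges N I x' y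

lemma ExchangeStep.of_subset (h : ExchangeStep M N I x x') (hM : M.Indep J) (hN : N.Indep J)
    (hIJ : I ⊆ J) : ExchangeStep M N J x x' := by
  obtain ⟨y, hx, hx'⟩ := h
  exact ⟨y, (exchanges_congr_of_subset hM hIJ hx.1).1 hx,
    (exchanges_congr_of_subset hN hIJ hx'.1).1 hx'⟩

lemma exchangeStep_insert_sdiff_iff (hMI : M.Indep I) (hMI' : M.Indep (insert z (I \ {y})))
    (hzy : Exchanges N I z y) (hx : x ∈ M.closure I) (hxz : ¬ ExchangeStep M N I x z) :
    ExchangeStep M N (insert z (I \ {y})) x x' ↔ ExchangeStep M N I x x' := by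
  have hxK : x ∈ M.closure (I \ {y}) :=
    by_contra fun h ↦ hxz ⟨y, ⟨hx, hzy.2.1, h⟩, hzy⟩
  refine exists_congr fun y' ↦ ?_
  rw [← exchanges_congr_of_subset hMI' (Set.subset_insert z _) hxK,
    exchanges_congr_of_subset hMI Set.sdiff_subset hxK]
  exact and_congr_right fun h ↦ exchanges_insert_sdiff_iff hzy h.2.1 fun h' ↦ hxz ⟨y', h, h'⟩

/-- `Z` is closed under the exchange steps of `I`. -/
def IsExchangeClosed (M N : Matroid α) (I Z : Set α) : Prop :=
  ∀ ⦃x⦄, x ∈ Z → ∀ ⦃x'⦄, ExchangeStep M N I x x' → x' ∈ Z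

/-- The elements reachable from `X` by exchange steps of `I`. -/
def reach (M N : Matroid α) (I X : Set α) : Set α :=
  {z | ∃ x ∈ X, Relation.ReflTransGen (ExchangeStep M N I) x z}

lemma subset_reach : X ⊆ reach M N I X :=
  fun x hx ↦ ⟨x, hx, .refl⟩

lemma isExchangeClosed_reach : IsExchangeClosed M N I (reach M N I X) :=
  fun _ ⟨x, hx, h⟩ _ hstep ↦ ⟨x, hx, h.tail hstep⟩

lemma IsExchangeClosed.reach_subset (h : IsExchangeClosed M N I Z) (hX : X ⊆ Z) :
    reach M N I X ⊆ Z := by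
  rintro z ⟨x, hx, hxz⟩
  induction hxz with
  | refl => exact hX hx
  | tail _ hstep ih => exact h ih hstep

lemma reach_mono (h : X ⊆ Y) : reach M N I X ⊆ reach M N I Y :=
  isExchangeClosed_reach.reach_subset (h.trans subset_reach)

lemma IsExchangeClosed.subset_closure_inter (h : IsExchangeClosed M N I Z) (hM : M.Indep I)
    (hN : N.Indep I) (hZ : Z ⊆ M.closure I) : Z ⊆ M.closure (I ∩ Z) :=
  fun _ hx ↦ mem_closure_of_forall_exchanges_mem hM Set.inter_subset_left (hZ hx)
    fun y hxy ↦ ⟨hxy.2.1, h hx ⟨y, hxy, exchanges_self hN hxy.2.1⟩⟩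

lemma IsExchangeClosed.closure_sdiff_subset (h : IsExchangeClosed M N I Z) (hM : M.Indep I)
    (hN : N.Indep I) : N.closure I \ Z ⊆ N.closure (I \ Z) :=
  fun _ hx ↦ mem_closure_of_forall_exchanges_mem hN Set.sdiff_subset hx.1
    fun y hxy ↦ ⟨hxy.2.1, fun hyZ ↦ hx.2 (h hyZ ⟨y, exchanges_self hM hxy.2.1, hxy⟩)⟩

/-- `J` agrees with `I` on every exchange-closed set of `M`-spanned elements and keeps the
exchange steps there. -/
def Preserves (M N : Matroid α) (I J : Set α) : Prop :=
  ∀ ⦃Z⦄, IsExchangeClosed M N I Z → Z ⊆ M.closure I →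
    I ∩ Z ⊆ J ∧ ∀ x ∈ Z, ∀ x', ExchangeStep M N I x x' → ExchangeStep M N J x x'

lemma preserves_of_subset (hM : M.Indep J) (hN : N.Indep J) (hIJ : I ⊆ J) :
    Preserves M N I J :=
  fun _ _ _ ↦ ⟨Set.inter_subset_left.trans hIJ, fun _ _ _ h ↦ h.of_subset hM hN hIJ⟩

lemma Preserves.of_subset (h : Preserves M N I J) (hM : M.Indep K) (hN : N.Indep K)
    (hJK : J ⊆ K) : Preserves M N I K :=
  fun _ hZ hZI ↦ ⟨(h hZ hZI).1.trans hJK,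
    fun x hx x' hstep ↦ ((h hZ hZI).2 x hx x' hstep).of_subset hM hN hJK⟩

lemma Preserves.reach_subset (h : Preserves M N I J) (hX : reach M N I X ⊆ M.closure I) :
    reach M N I X ⊆ reach M N J X := by
  rintro z ⟨x, hx, hxz⟩
  refine ⟨x, hx, ?_⟩
  induction hxz with
  | refl => exact .refl
  | tail hab hbc ih => exact ih.tail ((h isExchangeClosed_reach hX).2 _ ⟨x, hx, hab⟩ _ hbc)

end Exchange

section Augment

variable {I J : Set α} {x y z : α} {n : ℕ}

lemma Exchanges.notMem_closure_insert_sdiff (h : Exchanges M I x y)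
    (hzI : z ∉ M.closure I) : x ∉ M.closure (insert z (I \ {y})) := by
  intro hx
  have hzx := mem_closure_insert h.2.2 hx
  rw [h.closure_eq] at hzx
  exact hzI hzx

lemma Exchanges.closure_insert_insert_sdiff (h : Exchanges M I x y) :
    M.closure (insert x (insert z (I \ {y}))) = M.closure (insert z I) := by
  rw [Set.insert_comm, M.closure_insert_congr_right h.closure_eq]

/-- After `z` has replaced `y`, the elements of an exchange-closed set of `M`-spanned elements have
the same exchange steps, since such a set contains neither `y` nor `z`. -/
lemma Preserves.of_insert_sdiff (hMI : M.Indep I) (hMI' : M.Indep (insert z (I \ {y})))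
    (hzy : Exchanges N I z y) (hz : z ∉ M.closure I)
    (h : Preserves M N (insert z (I \ {y})) J) : Preserves M N I J := by
  intro Z hZ hZI
  have hxz : ∀ {x}, x ∈ Z → ¬ ExchangeStep M N I x z := fun hx h ↦ hz (hZI (hZ hx h))
  have hstep : ∀ {x x'}, x ∈ Z →
      (ExchangeStep M N (insert z (I \ {y})) x x' ↔ ExchangeStep M N I x x') :=
    fun hx ↦ exchangeStep_insert_sdiff_iff hMI hMI' hzy (hZI hx) (hxz hx)
  have hZI' : Z ⊆ M.closure (insert z (I \ {y})) := fun x hx ↦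
    M.closure_subset_closure (Set.subset_insert z _)
      (by_contra fun h ↦ hxz hx ⟨y, ⟨hZI hx, hzy.2.1, h⟩, hzy⟩)
  obtain ⟨hsub, hpres⟩ := h (fun x hx x' h ↦ hZ hx ((hstep hx).1 h)) hZI'
  refine ⟨fun a ⟨haI, haZ⟩ ↦ hsub ⟨Or.inr ⟨haI, ?_⟩, haZ⟩,
    fun x hx x' h ↦ hpres x hx x' ((hstep hx).2 h)⟩
  rintro rfl
  exact hxz haZ ⟨a, exchanges_self hMI haI, hzy⟩

/-- Augmentation along an alternating walk `v`: letting `v n` replace its predecessor on a shortcut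
`v i → y → v n` with `i` least leaves the walk up to `v i` intact. -/
lemma exists_augment_of_walk {v : ℕ → α} (hMI : M.Indep I) (hNI : N.Indep I)
    (hv₀ : v 0 ∈ N.E) (hv₀I : v 0 ∉ N.closure I) (hvn : v n ∈ M.E) (hvnI : v n ∉ M.closure I)
    (hv : ∀ i < n, ExchangeStep M N I (v i) (v (i + 1))) :
    ∃ J, M.Indep J ∧ N.Indep J ∧ M.closure J = M.closure (insert (v n) I) ∧
      N.closure J = N.closure (insert (v 0) I) ∧ Preserves M N I J := by
  induction n using Nat.strong_induction_on generalizing I with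
  | h n ih =>
  obtain rfl | hn := n.eq_zero_or_pos
  · have hM := hMI.insert_indep_iff.2 (.inl ⟨hvn, hvnI⟩)
    have hN := hNI.insert_indep_iff.2 (.inl ⟨hv₀, hv₀I⟩)
    exact ⟨insert (v 0) I, hM, hN, rfl, rfl, preserves_of_subset hM hN (Set.subset_insert _ _)⟩
  have hex : ∃ i < n, ExchangeStep M N I (v i) (v n) :=
    ⟨n - 1, by omega, by simpa [Nat.sub_add_cancel hn] using hv (n - 1) (by omega)⟩
  classical
  obtain ⟨hi, y, hviy, hvny⟩ := Nat.find_spec hex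
  set i := Nat.find hex
  have hmin : ∀ j < i, ¬ ExchangeStep M N I (v j) (v n) :=
    fun j hj h ↦ Nat.find_min hex hj ⟨hj.trans hi, h⟩
  have hM : M.Indep (insert (v n) (I \ {y})) :=
    (hMI.subset Set.sdiff_subset).insert_indep_iff.2
      (.inl ⟨hvn, fun h ↦ hvnI (M.closure_subset_closure Set.sdiff_subset h)⟩)
  have hN : N.Indep (insert (v n) (I \ {y})) :=
    (hNI.subset Set.sdiff_subset).insert_indep_iff.2
      (.inl ⟨mem_ground_of_mem_closure hvny.1, hvny.2.2⟩)
  have hspan : ∀ j < n, v j ∈ M.closure I := fun j hj ↦ (hv j hj).choose_spec.1.1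
  obtain ⟨J, hMJ, hNJ, hclM, hclN, hJ⟩ := ih i hi hM hN (by rwa [hvny.closure_eq])
    (mem_ground_of_mem_closure hviy.1) (hviy.notMem_closure_insert_sdiff hvnI)
    fun j hj ↦ (exchangeStep_insert_sdiff_iff hMI hM hvny (hspan j (hj.trans hi)) (hmin j hj)).2
      (hv j (hj.trans hi))
  refine ⟨J, hMJ, hNJ, ?_, ?_, hJ.of_insert_sdiff hMI hM hvny hvnI⟩
  · rw [hclM, hviy.closure_insert_insert_sdiff]
  · rw [hclN, N.closure_insert_congr_right hvny.closure_eq]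

lemma exists_walk_of_reflTransGen {r : α → α → Prop} (h : Relation.ReflTransGen r x z) :
    ∃ (v : ℕ → α) (n : ℕ), v 0 = x ∧ v n = z ∧ ∀ i < n, r (v i) (v (i + 1)) := by
  induction h using Relation.ReflTransGen.head_induction_on with
  | refl => exact ⟨fun _ ↦ z, 0, rfl, rfl, by simp⟩
  | @head a b hxy _ ih =>
    obtain ⟨v, n, rfl, hvn, hv⟩ := ih
    refine ⟨fun i ↦ Nat.casesOn i a v, n + 1, rfl, hvn, fun i hi ↦ ?_⟩
    cases i with
    | zero => exact hxy
    | succ i => exact hv i (Nat.lt_of_succ_lt_succ hi)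

/-- `x` is augmentable for `I`: it is not `N`-spanned by `I`, and some element reachable from it is
not `M`-spanned by `I`. -/
def Augmentable (M N : Matroid α) (I : Set α) (x : α) : Prop :=
  x ∈ N.E ∧ x ∉ N.closure I ∧ ¬ reach M N I {x} ⊆ M.closure I

lemma Augmentable.exists_augment (hE : M.E = N.E) (hMI : M.Indep I) (hNI : N.Indep I)
    (hx : Augmentable M N I x) : ∃ z ∈ M.E, z ∉ M.closure I ∧ ∃ J, M.Indep J ∧ N.Indep J ∧
      M.closure J = M.closure (insert z I) ∧ N.closure J = N.closure (insert x I) ∧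
      Preserves M N I J := by
  obtain ⟨hxE, hxI, hreach⟩ := hx
  obtain ⟨z, ⟨_, rfl, hxz⟩, hz⟩ := Set.not_subset.1 hreach
  have hzE : z ∈ N.E := by
    obtain rfl | ⟨_, -, _, -, hz⟩ := hxz.cases_tail
    exacts [hxE, mem_ground_of_mem_closure hz.1]
  obtain ⟨v, n, rfl, rfl, hv⟩ := exists_walk_of_reflTransGen hxz
  exact ⟨v n, hE ▸ hzE, hz, exists_augment_of_walk hMI hNI hxE hxI (hE ▸ hzE) hz hv⟩

end Augment

section Nice

variable {B I J S W : Set α} {z : α}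

/-- The wave consists of the elements reachable from outside the `N`-closure of `B`. -/
lemma exists_augment_or_isWave (hE : M.E = N.E) (hBM : M.Indep B) (hBN : N.Indep B) :
    (∃ z ∈ M.E, z ∉ M.closure B ∧ ∃ J, N.Indep J ∧ M.closure J = M.closure (insert z B)) ∨
      ∃ R, IsWave M N R ∧ N.E \ R ⊆ N.closure B := by
  by_cases h : ∃ x, Augmentable M N B x
  · obtain ⟨x, hx⟩ := h
    obtain ⟨z, hz, hzB, J, -, hJN, hJ, -, -⟩ := hx.exists_augment hE hBM hBN
    exact .inl ⟨z, hz, hzB, J, hJN, hJ⟩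
  right
  set R := reach M N B (N.E \ N.closure B)
  have hR : R ⊆ M.closure B := by
    rintro z ⟨x, hx, hxz⟩
    exact not_not.1 (fun hreach ↦ h ⟨x, hx.1, hx.2, hreach⟩) ⟨x, rfl, hxz⟩
  have hRN : N.E \ R ⊆ N.closure B :=
    fun x hx ↦ by_contra fun hxB ↦ hx.2 (subset_reach ⟨hx.1, hxB⟩)
  have hspan : (N.E \ R) ∩ N.E ⊆ N.closure (B ∩ (N.E \ R)) := by
    rw [← Set.inter_sdiff_assoc, Set.inter_eq_self_of_subset_left hBN.subset_ground]
    exact fun x hx ↦ isExchangeClosed_reach.closure_sdiff_subset hBM hBN ⟨hRN hx.1, hx.1.2⟩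
  refine ⟨R, ⟨B ∩ R, Set.inter_subset_right,
    isExchangeClosed_reach.subset_closure_inter hBM hBN hR, ?_⟩, hRN⟩
  exact (sdiff_indep_contract_of_inter_subset_closure hBN hspan).subset fun x hx ↦
    ⟨hx.1, fun h ↦ h.2 hx.2⟩

lemma TrivialWaves.subset_closure_of_subset_closure_insert (h : TrivialWaves M N) (hE : M.E = N.E)
    (hW : W ⊆ N.E) (hBW : B ⊆ W) (hBM : M.Indep B) (hBN : (N ／ (N.E \ W)).Indep B)
    (hzW : z ∈ W) (hz : z ∉ M.loops) (hWz : W ⊆ M.closure (insert z B)) :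
    W ⊆ N.closure (N.E \ W ∪ B) := by
  have hground : (M ↾ W).E = (N ／ (N.E \ W)).E := by
    rw [restrict_ground_eq, contract_ground, Set.sdiff_sdiff_cancel_left hW]
  have hclz : W ⊆ (M ↾ W).closure (insert z B) := by
    rw [M.restrict_closure_eq (Set.insert_subset hzW hBW) (hE ▸ hW)]
    exact Set.subset_inter hWz subset_rfl
  obtain ⟨w, hw, hwB, J, hJN, hJ⟩ | ⟨R, hR, hRN⟩ :=
    exists_augment_or_isWave hground (restrict_indep_iff.2 ⟨hBM, hBW⟩) hBN
  · have hWJ : W ⊆ (M ↾ W).closure J := by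
      rwa [hJ, closure_insert_congr ⟨hclz hw, hwB⟩]
    have hJW : J ⊆ W := hJN.subset_ground.trans hground.symm.subset
    rw [M.restrict_closure_eq hJW (hE ▸ hW)] at hWJ
    have hwave : IsWave M N W := ⟨J, hJW, hWJ.trans Set.inter_subset_left, hJN⟩
    exact (hz (h.subset_loops hwave hzW)).elim
  · have hRloops := h.subset_loops (hR.of_restrict_contract (hE ▸ hW) hW)
    rw [← hground, restrict_ground_eq, contract_closure_eq, Set.union_comm] at hRN
    have hsub : N.E \ M.loops ⊆ N.closure (N.E \ W ∪ B) := fun x hx ↦ by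
      by_cases hxW : x ∈ W
      · exact (hRN ⟨hxW, fun hxR ↦ hx.2 (hRloops hxR)⟩).1
      · exact N.mem_closure_of_mem' (Or.inl ⟨hx.1, hxW⟩) hx.1
    exact (hW.trans h.subset_closure).trans (closure_subset_closure_of_subset_closure hsub)

/-- A common independent set whose contraction leaves only trivial waves. -/
structure IsNice (M N : Matroid α) (I : Set α) : Prop where
  indep_left : M.Indep I
  indep_right : N.Indep I
  trivialWaves : TrivialWaves (M ／ I) (N ／ I)

lemma trivialWaves_contract
    (hW : ∀ W, IsWave (M ／ I) (N ／ I) W → W ⊆ M.closure I)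
    (hN : N.E ⊆ N.closure (N.E \ M.closure I ∪ I)) : TrivialWaves (M ／ I) (N ／ I) where
  subset_loops W h := by
    rw [contract_loops_eq]
    exact fun x hx ↦ ⟨hW W h hx, (h.subset_ground hx).2⟩
  subset_closure := by
    rw [contract_loops_eq, contract_closure_eq]
    refine fun x hx ↦ ⟨N.closure_subset_closure (Set.union_subset (fun y hy ↦ ?_) ?_) (hN hx.1),
      hx.2⟩
    · by_cases hyI : y ∈ I
      exacts [Or.inr hyI, Or.inl ⟨⟨hy.1, hyI⟩, fun h ↦ hy.2 h.1⟩]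
    · exact Set.subset_union_right

lemma IsNice.sdiff_subset_closure (hI : IsNice M N I) (hE : M.E = N.E) (hSE : S ⊆ N.E)
    (hBS : B ⊆ S) (hBM : (M ／ I).Indep B) (hBN : (N ／ (I ∪ (N.E \ S))).Indep B) (hz : z ∈ S)
    (hzI : z ∉ M.closure I) (hS : S ⊆ M.closure (insert z (I ∪ B))) :
    S \ I ⊆ N.closure (N.E \ S ∪ (I ∪ B)) := by
  have hcompl : (N.E \ I) \ (S \ I) ⊆ N.E \ S := fun x hx ↦
    ⟨hx.1.1, fun hxS ↦ hx.2 ⟨hxS, hx.1.2⟩⟩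
  have hindep : ((N ／ I) ／ ((N ／ I).E \ (S \ I))).Indep B := by
    rw [contract_contract, contract_ground]
    exact contract_indep_of_subset hBN (Set.union_subset_union_right I hcompl)
  have hspan : S \ I ⊆ (M ／ I).closure (insert z B) := by
    rw [contract_closure_eq, Set.insert_union, Set.union_comm B]
    exact Set.sdiff_subset_sdiff_left hS
  have hBI : Disjoint B I := (Set.subset_sdiff.1 hBM.subset_ground).2
  have hzI' : z ∉ I := fun h ↦ hzI (M.mem_closure_of_mem h hI.indep_left.subset_ground)
  have key := hI.trivialWaves.subset_closure_of_subset_closure_insert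
    (by rw [contract_ground, contract_ground, hE]) (Set.sdiff_subset_sdiff_left hSE)
    (Set.subset_sdiff.2 ⟨hBS, hBI⟩) hBM hindep ⟨hz, hzI'⟩
    (fun h ↦ hzI (contract_loops_eq M I ▸ h).1) hspan
  rw [contract_closure_eq, contract_ground, Set.union_assoc, Set.union_comm B] at key
  exact (key.trans Set.sdiff_subset).trans
    (N.closure_subset_closure (Set.union_subset_union_left _ hcompl))

lemma IsNice.subset_closure_of_closure_eq (hI : IsNice M N I) (hE : M.E = N.E)
    (hJN : N.Indep J) (hIJ : I ⊆ N.closure J) (hz : z ∈ M.E) (hzI : z ∉ M.closure I)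
    (hJM : M.closure J = M.closure (insert z I)) (hBM : (M ／ J).Indep B)
    (hBN : (N ／ (J ∪ (N.E \ M.closure (J ∪ B)))).Indep B) :
    N.E ⊆ N.closure (N.E \ M.closure (J ∪ B) ∪ (J ∪ B)) := by
  set S := M.closure (J ∪ B)
  set T := N.E \ S ∪ (J ∪ B)
  have hIJM : I ⊆ M.closure J := by
    rw [hJM]
    exact M.subset_closure_of_subset' (Set.subset_insert z I) hI.indep_left.subset_ground
  have hTE : T ⊆ N.closure T := N.subset_closure T (Set.union_subset Set.sdiff_subset
    (Set.union_subset hJN.subset_ground hBN.of_contract.subset_ground))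
  have hIT : I ⊆ N.closure T :=
    hIJ.trans (N.closure_subset_closure (Set.subset_union_left.trans Set.subset_union_right))
  have hindep : (N ／ (I ∪ (N.E \ S))).Indep B :=
    contract_indep_of_subset_closure hBN (Set.union_subset
      (hIJ.trans (N.closure_subset_closure Set.subset_union_left))
      (N.subset_closure_of_subset' Set.subset_union_right Set.sdiff_subset))
  have key : S \ I ⊆ N.closure (N.E \ S ∪ (I ∪ B)) := by
    refine hI.sdiff_subset_closure hE (hE ▸ M.closure_subset_ground _)
      (M.subset_closure_of_subset' Set.subset_union_right hBM.of_contract.subset_ground)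
      (contract_indep_of_subset_closure hBM hIJM) hindep
      (M.closure_subset_closure Set.subset_union_left
        (hJM ▸ M.mem_closure_of_mem' (Set.mem_insert z I))) hzI ?_
    rw [← Set.insert_union, ← closure_union_closure_left_eq, ← hJM, closure_union_closure_left_eq]
  have hsub : N.E \ S ∪ (I ∪ B) ⊆ N.closure T :=
    Set.union_subset (Set.subset_union_left.trans hTE)
      (Set.union_subset hIT ((Set.subset_union_right.trans Set.subset_union_right).trans hTE))
  intro x hx
  by_cases hxS : x ∈ S
  · by_cases hxI : x ∈ I
    exacts [hIT hxI, closure_subset_closure_of_subset_closure hsub (key ⟨hxS, hxI⟩)]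
  · exact hTE (Or.inl ⟨hx, hxS⟩)

/-- Contracting a maximal wave for `(M ／ J, N ／ J)` restores niceness. -/
lemma IsNice.exists_superset (hI : IsNice M N I) (hE : M.E = N.E) (hJM : M.Indep J)
    (hJN : N.Indep J) (hIJ : I ⊆ N.closure J) (hz : z ∈ M.E) (hzI : z ∉ M.closure I)
    (hJ : M.closure J = M.closure (insert z I)) : ∃ K, J ⊆ K ∧ IsNice M N K := by
  obtain ⟨B, hBM, hB, hBN⟩ := exists_indep_closure_eq_maxWave (M ／ J) (N ／ J)
  have hBmax : B ⊆ maxWave (M ／ J) (N ／ J) := hB ▸ (M ／ J).subset_closure B hBM.subset_ground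
  have hBN' : (N ／ (J ∪ (N.E \ M.closure (J ∪ B)))).Indep B := by
    rw [contract_contract, contract_ground, ← hB, contract_closure_eq, Set.union_comm B] at hBN
    refine contract_indep_of_subset hBN (Set.union_subset Set.subset_union_left fun x hx ↦ ?_)
    by_cases hxJ : x ∈ J
    exacts [Or.inl hxJ, Or.inr ⟨⟨hx.1, hxJ⟩, fun h ↦ hx.2 h.1⟩]
  refine ⟨J ∪ B, Set.subset_union_left, ⟨?_, ?_, trivialWaves_contract (fun W hW ↦ ?_)
    (hI.subset_closure_of_closure_eq hE hJN hIJ hz hzI hJ hBM hBN')⟩⟩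
  · exact Set.union_comm B J ▸ union_indep_of_contract_indep hBM hJM subset_rfl
  · exact Set.union_comm B J ▸ union_indep_of_contract_indep hBN' hJN Set.subset_union_left
  · rw [← contract_contract, ← contract_contract] at hW
    refine (hW.subset_maxWave_of_contract hBmax).trans ?_
    rw [← hB, contract_closure_eq, Set.union_comm]
    exact Set.sdiff_subset

end Nice

section Countable

variable {I : Set α} {e : α}

open Filter

lemma IsNice.exists_forall_augmentable (hI : IsNice M N I) (hE : M.E = N.E) (g : α → ℕ) :
    ∃ J, IsNice M N J ∧ N.closure I ⊆ N.closure J ∧ Preserves M N I J ∧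
      ∀ x, Augmentable M N I x → ∃ x', Augmentable M N I x' ∧ g x' ≤ g x ∧ x' ∈ N.closure J := by
  by_cases hex : ∃ x, Augmentable M N I x
  · obtain ⟨x, hx, hmin⟩ := (InvImage.wf g wellFounded_lt).has_min {x | Augmentable M N I x} hex
    obtain ⟨z, hz, hzI, J, hJM, hJN, hclM, hclN, hJ⟩ :=
      hx.exists_augment hE hI.indep_left hI.indep_right
    have hxI : insert x I ⊆ N.closure J := hclN ▸
      N.subset_closure _ (Set.insert_subset hx.1 hI.indep_right.subset_ground)
    have hIJ : I ⊆ N.closure J := (Set.subset_insert x I).trans hxI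
    obtain ⟨K, hJK, hK⟩ := hI.exists_superset hE hJM hJN hIJ hz hzI hclM
    have hcl := N.closure_subset_closure hJK
    exact ⟨K, hK, closure_subset_closure_of_subset_closure (hIJ.trans hcl),
      hJ.of_subset hK.indep_left hK.indep_right hJK,
      fun x' hx' ↦ ⟨x, hx, not_lt.1 (hmin x' hx'), hcl (hxI (Set.mem_insert x I))⟩⟩
  · exact ⟨I, hI, subset_rfl, preserves_of_subset hI.indep_left hI.indep_right subset_rfl,
      fun x hx ↦ (hex ⟨x, hx⟩).elim⟩

/-- By induction on `k`, eventually `P n x` forces `k ≤ g x`. -/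
lemma eventually_not_of_exists_le {E : Set α} {P : ℕ → α → Prop} {g : α → ℕ}
    (hg : Set.InjOn g E) (hP : ∀ n x, P n x → x ∈ E)
    (h : ∀ n x, P n x → ∃ x' ∈ E, g x' ≤ g x ∧ P n x' ∧ ∀ m > n, ¬ P m x') (x : α) :
    ∀ᶠ n in atTop, ¬ P n x := by
  suffices hle : ∀ k, ∀ᶠ n in atTop, ∀ x, P n x → k ≤ g x from
    (hle (g x + 1)).mono fun n hn hx ↦ Nat.not_succ_le_self _ (hn x hx)
  intro k
  induction k with
  | zero => exact .of_forall fun _ _ _ ↦ Nat.zero_le _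
  | succ k ih =>
    obtain ⟨n, hn⟩ := eventually_atTop.1 ih
    by_cases hex : ∃ m ≥ n, ∃ x, P m x ∧ g x = k
    · obtain ⟨m, hm, x, hx, rfl⟩ := hex
      obtain ⟨x', hx'E, hle, hx', hgone⟩ := h m x hx
      have heq : g x' = g x := hle.antisymm (hn m hm x' hx')
      filter_upwards [eventually_gt_atTop m] with l hl y hy
      refine (hn l (hm.trans hl.le) y hy).lt_of_ne fun hxy ↦ hgone l hl ?_
      rwa [hg hx'E (hP l y hy) (heq.trans hxy)]
    · push Not at hex
      exact eventually_atTop.2 ⟨n, fun m hm x hx ↦ (hn m hm x hx).lt_of_ne (hex m hm x hx).symm⟩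

lemma exists_augmenting_sequence (hE : M.E = N.E) (hc : N.E.Countable) (h : TrivialWaves M N) :
    ∃ I : ℕ → Set α, (∀ n, IsNice M N (I n)) ∧ (Monotone fun n ↦ N.closure (I n)) ∧
      (∀ n, Preserves M N (I n) (I (n + 1))) ∧
      ∀ x, ∀ᶠ n in atTop, ¬ Augmentable M N (I n) x := by
  obtain ⟨g, hg⟩ := Set.countable_iff_exists_injOn.1 hc
  have h₀ : IsNice M N ∅ := ⟨M.empty_indep, N.empty_indep, by simpa only [contract_empty]⟩
  choose next hnice hcl hpres haug using
    fun I : {I // IsNice M N I} ↦ I.2.exists_forall_augmentable hE g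
  let I : ℕ → {I // IsNice M N I} :=
    fun n ↦ Nat.rec ⟨∅, h₀⟩ (fun _ J ↦ ⟨next J, hnice J⟩) n
  have hmono : Monotone fun n ↦ N.closure (I n).1 :=
    monotone_nat_of_le_succ fun n ↦ hcl (I n)
  refine ⟨fun n ↦ (I n).1, fun n ↦ (I n).2, hmono, fun n ↦ hpres (I n),
    eventually_not_of_exists_le hg (fun n x hx ↦ hx.1) fun n x hx ↦ ?_⟩
  obtain ⟨x', hx', hle, hmem⟩ := haug (I n) x hx
  exact ⟨x', hx'.1, hle, hx', fun m hm hx'' ↦ hx''.2.1 (hmono hm hmem)⟩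

/-- Finitariness makes a circuit in the limit visible at some stage `k`. -/
lemma isWave_iUnion_of_monotone [N.Finitary] {J Z : ℕ → Set α} (hJ : ∀ k, N.Indep (J k))
    (hJZ : Monotone fun k ↦ J k ∩ Z k) (hM : ∀ k, Z k ⊆ M.closure (J k ∩ Z k))
    (hN : ∀ k, N.closure (J k) \ Z k ⊆ N.closure (J k \ Z k))
    (hcov : ∀ x ∈ N.E \ ⋃ k, Z k, ∀ᶠ k in atTop, x ∈ N.closure (J k)) :
    IsWave M N (⋃ k, Z k) := by
  refine ⟨⋃ k, J k ∩ Z k, Set.iUnion_mono fun k ↦ Set.inter_subset_right,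
    Set.iUnion_subset fun k ↦ (hM k).trans
      (M.closure_subset_closure (Set.subset_iUnion (fun k ↦ J k ∩ Z k) k)), ?_⟩
  have hmem : ∀ {b}, b ∈ ⋃ k, J k ∩ Z k → ∀ᶠ k in atTop, b ∈ J k ∩ Z k := fun hb ↦
    let ⟨k, hk⟩ := Set.mem_iUnion.1 hb
    eventually_atTop.2 ⟨k, fun l hl ↦ hJZ hl hk⟩
  refine contract_indep_iff_forall_notMem_closure.2 ⟨Set.iUnion_subset fun k ↦
    Set.inter_subset_left.trans (hJ k).subset_ground, fun b hb hcl ↦ ?_⟩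
  obtain ⟨F, hF, hFfin, -, hbF⟩ := exists_mem_finite_closure_of_mem_closure hcl
  have hev : ∀ x ∈ F, ∀ᶠ k in atTop, x ∈ N.closure (J k \ {b}) := by
    intro x hx
    obtain hxZ | ⟨hxJ, hxb⟩ := hF hx
    · filter_upwards [hcov x hxZ, hmem hb] with k hk hbk
      refine N.closure_subset_closure ?_ (hN k ⟨hk, fun h ↦ hxZ.2 (Set.mem_iUnion.2 ⟨k, h⟩)⟩)
      exact Set.sdiff_subset_sdiff_right (Set.singleton_subset_iff.2 hbk.2)
    · filter_upwards [hmem hxJ] with k hk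
      exact N.mem_closure_of_mem' ⟨hk.1, hxb⟩ ((hJ k).subset_ground hk.1)
  obtain ⟨k, hk, hbk⟩ := (((eventually_all_finite hFfin).2 hev).and (hmem hb)).exists
  exact (hJ k).notMem_closure_sdiff_of_mem hbk.1 (closure_subset_closure_of_subset_closure hk hbF)

/-- The wave consists of the elements reachable, from some stage on, from those that are never
spanned in `N`. -/
lemma exists_isWave_of_sequence [N.Finitary] {I : ℕ → Set α} (hMI : ∀ n, M.Indep (I n))
    (hNI : ∀ n, N.Indep (I n)) (hmono : Monotone fun n ↦ N.closure (I n))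
    (hpres : ∀ n, Preserves M N (I n) (I (n + 1)))
    (haug : ∀ x, ∀ᶠ n in atTop, ¬ Augmentable M N (I n) x) :
    ∃ W, IsWave M N W ∧ ∀ x ∈ N.E \ W, ∀ᶠ n in atTop, x ∈ N.closure (I n) := by
  let X : ℕ → Set α := fun n ↦
    {x ∈ N.E | (∀ m, x ∉ N.closure (I m)) ∧ ∀ m ≥ n, ¬ Augmentable M N (I m) x}
  let Z : ℕ → Set α := fun n ↦ reach M N (I n) (X n)
  have hX : ∀ n, X n ⊆ X (n + 1) := fun n x hx ↦
    ⟨hx.1, hx.2.1, fun m hm ↦ hx.2.2 m (Nat.le_of_succ_le hm)⟩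
  have hZM : ∀ n, Z n ⊆ M.closure (I n) := by
    rintro n z ⟨x, ⟨hxE, hxI, hx⟩, hxz⟩
    exact not_not.1 (fun h ↦ hx n le_rfl ⟨hxE, hxI n, h⟩) ⟨x, rfl, hxz⟩
  have hZ : ∀ n, Z n ⊆ Z (n + 1) := fun n ↦
    ((hpres n).reach_subset (hZM n)).trans (reach_mono (hX n))
  have hcov : ∀ x ∈ N.E \ ⋃ n, Z n, ∀ᶠ n in atTop, x ∈ N.closure (I n) := by
    rintro x ⟨hxE, hxZ⟩
    obtain ⟨n, hn⟩ := eventually_atTop.1 (haug x)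
    by_contra hx
    refine hxZ (Set.mem_iUnion.2 ⟨n, subset_reach ⟨hxE, fun m hm ↦ hx ?_, hn⟩⟩)
    exact eventually_atTop.2 ⟨m, fun l hl ↦ hmono hl hm⟩
  refine ⟨⋃ n, Z n, isWave_iUnion_of_monotone hNI (monotone_nat_of_le_succ fun n ↦ ?_)
    (fun n ↦ isExchangeClosed_reach.subset_closure_inter (hMI n) (hNI n) (hZM n))
    (fun n ↦ isExchangeClosed_reach.closure_sdiff_subset (hMI n) (hNI n)) hcov, hcov⟩
  exact Set.subset_inter (hpres n isExchangeClosed_reach (hZM n)).1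
    (Set.inter_subset_right.trans (hZ n))

lemma TrivialWaves.exists_isNice_mem_closure [N.Finitary] (h : TrivialWaves M N) (hE : M.E = N.E)
    (hc : N.E.Countable) (he : e ∈ N.E) : ∃ I, IsNice M N I ∧ e ∈ N.closure I := by
  obtain ⟨I, hI, hmono, hpres, haug⟩ := exists_augmenting_sequence hE hc h
  obtain ⟨W, hW, hcov⟩ := exists_isWave_of_sequence (fun n ↦ (hI n).indep_left)
    (fun n ↦ (hI n).indep_right) hmono hpres haug
  have heW : e ∈ N.closure (N.E \ W) :=
    N.closure_subset_closure (Set.sdiff_subset_sdiff_right (h.subset_loops hW))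
      (h.subset_closure he)
  obtain ⟨F, hF, hFfin, -, heF⟩ := exists_mem_finite_closure_of_mem_closure heW
  obtain ⟨n, hn⟩ := ((eventually_all_finite hFfin).2 fun x hx ↦ hcov x (hF hx)).exists
  exact ⟨I n, hI n, closure_subset_closure_of_subset_closure hn heF⟩

end Countable

section Finitary

variable {I J W : Set α} {e : α}

lemma IsNice.contract_union (hI : IsNice M N I) (hJ : IsNice (M ／ I) (N ／ I) J) :
    IsNice M N (I ∪ J) where
  indep_left := Set.union_comm J I ▸
    union_indep_of_contract_indep hJ.indep_left hI.indep_left subset_rfl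
  indep_right := Set.union_comm J I ▸
    union_indep_of_contract_indep hJ.indep_right hI.indep_right subset_rfl
  trivialWaves := by
    simpa only [contract_contract] using hJ.trivialWaves

lemma IsNice.exists_superset_mem_closure [N.Finitary] (hI : IsNice M N I) (hE : M.E = N.E)
    (hc : N.E.Countable) (he : e ∈ N.E) : ∃ K, IsNice M N K ∧ I ⊆ K ∧ e ∈ N.closure K := by
  by_cases heI : e ∈ I
  · exact ⟨I, hI, subset_rfl, N.mem_closure_of_mem' heI⟩
  obtain ⟨J, hJ, heJ⟩ := hI.trivialWaves.exists_isNice_mem_closure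
    (by rw [contract_ground, contract_ground, hE]) (hc.mono Set.sdiff_subset) ⟨he, heI⟩
  rw [contract_closure_eq, Set.union_comm] at heJ
  exact ⟨I ∪ J, hI.contract_union hJ, Set.subset_union_left, heJ.1⟩

lemma TrivialWaves.exists_indep_subset_closure [M.Finitary] [N.Finitary] (h : TrivialWaves M N)
    (hE : M.E = N.E) (hc : N.E.Countable) : ∃ I, M.Indep I ∧ N.E ⊆ N.closure I := by
  obtain hempty | hne := N.E.eq_empty_or_nonempty
  · exact ⟨∅, M.empty_indep, hempty.subset.trans (Set.empty_subset _)⟩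
  obtain ⟨f, hf⟩ := hc.exists_eq_range hne
  have h₀ : IsNice M N ∅ := ⟨M.empty_indep, N.empty_indep, by simpa only [contract_empty]⟩
  choose next hnice hsub hmem using fun (I : {I // IsNice M N I}) n ↦
    I.2.exists_superset_mem_closure hE hc (hf ▸ Set.mem_range_self n : f n ∈ N.E)
  let I : ℕ → {I // IsNice M N I} :=
    fun n ↦ Nat.rec ⟨∅, h₀⟩ (fun n J ↦ ⟨next J n, hnice J n⟩) n
  have hmono : Monotone fun n ↦ (I n).1 :=
    monotone_nat_of_le_succ fun n ↦ hsub (I n) n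
  refine ⟨⋃ n, (I n).1, indep_of_forall_finite_subset_indep _ fun F hF hFfin ↦ ?_, ?_⟩
  · obtain ⟨_, ⟨n, rfl⟩, hn⟩ :=
      hmono.directed_le.directedOn_range.exists_mem_subset_of_finite_of_subset_sUnion
        (Set.range_nonempty _) hFfin hF
    exact (I n).2.indep_left.subset hn
  · rw [hf, Set.range_subset_iff]
    exact fun n ↦ N.closure_subset_closure (Set.subset_iUnion (fun n ↦ (I n).1) (n + 1))
      (hmem (I n) n)

lemma contract_indep_of_delete {D B X : Set α} (h : ((N ＼ D) ／ X).Indep B) (hX : Disjoint X D) :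
    (N ／ X).Indep B := by
  rw [← contract_delete_comm _ hX] at h
  exact h.of_delete

lemma eq_empty_of_isWave_contract_delete_maxWave
    (hW : IsWave (M ／ maxWave M N) (N ＼ maxWave M N) W) : W = ∅ := by
  have hWE := hW.subset_ground
  obtain ⟨B, hBW, hM, hN⟩ := hW
  have hdisj : Disjoint ((N ＼ maxWave M N).E \ W) (maxWave M N) :=
    Set.disjoint_left.2 fun x hx ↦ hx.1.2
  replace hN := contract_indep_of_delete hN hdisj
  rw [delete_ground, Set.sdiff_sdiff] at hN
  rw [contract_closure_eq, Set.union_comm B] at hM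
  have hmax := isWave_maxWave.union hBW (hM.trans Set.sdiff_subset) hN
  exact Set.eq_empty_of_forall_notMem fun x hx ↦
    (hWE hx).2 (hmax.subset_maxWave (Or.inr hx))

lemma trivialWaves_contract_delete_maxWave :
    TrivialWaves (M ／ maxWave M N) (N ＼ maxWave M N) := by
  have hloops : (M ／ maxWave M N).loops = ∅ :=
    eq_empty_of_isWave_contract_delete_maxWave
      ⟨∅, Set.empty_subset _, by rw [closure_empty], empty_indep _⟩
  refine ⟨fun W hW ↦ ?_, ?_⟩
  · rw [eq_empty_of_isWave_contract_delete_maxWave hW]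
    exact Set.empty_subset _
  · rw [hloops, Set.sdiff_empty, closure_ground]

lemma hasIntersection_of_finitary [M.Finitary] [N.Finitary] (hE : M.E = N.E)
    (hc : M.E.Countable) : HasIntersection M N := by
  have htrivial : TrivialWaves (M ／ maxWave M N) (N ＼ maxWave M N) :=
    trivialWaves_contract_delete_maxWave
  obtain ⟨J, hJM, hJN⟩ := htrivial.exists_indep_subset_closure
    (by rw [contract_ground, delete_ground, hE]) ((hE ▸ hc).mono Set.sdiff_subset)
  rw [delete_closure_eq, delete_ground, ← hE] at hJN
  refine ⟨maxWave M N, isWave_maxWave, J, hJM.subset_ground,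
    hJN.trans (Set.sdiff_subset.trans (N.closure_subset_closure Set.sdiff_subset)), ?_⟩
  rwa [Set.sdiff_sdiff_cancel_left isWave_maxWave.subset_ground]

end Finitary

section DirectSum

variable {β : Type*} {F C : Matroid α} {X : Set α} {e : α}

lemma inl_mem_sum_closure_iff {M : Matroid α} {N : Matroid β} {X : Set (α ⊕ β)} :
    Sum.inl e ∈ (M.sum N).closure X ↔ e ∈ M.closure (Sum.inl ⁻¹' X) := by
  obtain ⟨I, hI⟩ := (M.sum N).exists_isBasis (X ∩ (M.sum N).E)
  have hM := (sum_isBasis_iff.1 hI).1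
  have hground : (Sum.inl ⁻¹' (X ∩ (M.sum N).E) : Set α) = Sum.inl ⁻¹' X ∩ M.E := by ext; simp
  have hinl : (Sum.inl ⁻¹' insert (Sum.inl e) I : Set α) = insert e (Sum.inl ⁻¹' I) := by ext; simp
  have hinr : (Sum.inr ⁻¹' insert (Sum.inl e) I : Set β) = Sum.inr ⁻¹' I := by ext; simp
  rw [hground] at hM
  rw [← closure_inter_ground, ← hI.closure_eq_closure, ← M.closure_inter_ground,
    ← hM.closure_eq_closure, hI.indep.mem_closure_iff', hM.indep.mem_closure_iff', sum_indep_iff,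
    hinl, hinr, and_iff_left ((sum_indep_iff M N).1 hI.indep).2]
  simp

lemma inr_mem_sum_closure_iff {M : Matroid α} {N : Matroid β} {X : Set (α ⊕ β)} {e : β} :
    Sum.inr e ∈ (M.sum N).closure X ↔ e ∈ N.closure (Sum.inr ⁻¹' X) := by
  obtain ⟨I, hI⟩ := (M.sum N).exists_isBasis (X ∩ (M.sum N).E)
  have hN := (sum_isBasis_iff.1 hI).2
  have hground : (Sum.inr ⁻¹' (X ∩ (M.sum N).E) : Set β) = Sum.inr ⁻¹' X ∩ N.E := by ext; simp
  have hinl : (Sum.inl ⁻¹' insert (Sum.inr e) I : Set α) = Sum.inl ⁻¹' I := by ext; simp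
  have hinr : (Sum.inr ⁻¹' insert (Sum.inr e) I : Set β) = insert e (Sum.inr ⁻¹' I) := by ext; simp
  rw [hground] at hN
  rw [← closure_inter_ground, ← hI.closure_eq_closure, ← N.closure_inter_ground,
    ← hN.closure_eq_closure, hI.indep.mem_closure_iff', hN.indep.mem_closure_iff', sum_indep_iff,
    hinl, hinr, and_iff_right ((sum_indep_iff M N).1 hI.indep).1]
  simp

lemma sum_contract_indep {M : Matroid α} {N : Matroid β} {B X : Set (α ⊕ β)}
    (h : ((M.sum N) ／ X).Indep B) :
    (M ／ (Sum.inl ⁻¹' X)).Indep (Sum.inl ⁻¹' B) ∧ (N ／ (Sum.inr ⁻¹' X)).Indep (Sum.inr ⁻¹' B) := by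
  rw [contract_indep_iff_forall_notMem_closure] at h
  simp only [contract_indep_iff_forall_notMem_closure]
  refine ⟨⟨fun b hb ↦ by simpa using h.1 hb, fun b hb hcl ↦ h.2 _ hb ?_⟩,
    fun b hb ↦ by simpa using h.1 hb, fun b hb hcl ↦ h.2 _ hb ?_⟩
  · refine inl_mem_sum_closure_iff.2 (M.closure_subset_closure (fun x ↦ ?_) hcl)
    simp
  · refine inr_mem_sum_closure_iff.2 (N.closure_subset_closure (fun x ↦ ?_) hcl)
    simp

lemma finitary_sum (M : Matroid α) (N : Matroid β) [M.Finitary] [N.Finitary] :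
    (M.sum N).Finitary := by
  refine ⟨fun I h ↦ (sum_indep_iff M N).2 ⟨indep_of_forall_finite_subset_indep _ fun J hJ hJf ↦ ?_,
    indep_of_forall_finite_subset_indep _ fun J hJ hJf ↦ ?_⟩⟩
  · have hJ' := h (Sum.inl '' J) (Set.image_subset_iff.2 hJ) (hJf.image _)
    simpa [Set.preimage_image_eq _ Sum.inl_injective] using ((sum_indep_iff M N).1 hJ').1
  · have hJ' := h (Sum.inr '' J) (Set.image_subset_iff.2 hJ) (hJf.image _)
    simpa [Set.preimage_image_eq _ Sum.inr_injective] using ((sum_indep_iff M N).1 hJ').2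

lemma finitary_disjointSum [F.Finitary] [C.Finitary] (h : Disjoint F.E C.E) :
    (F.disjointSum C h).Finitary := by
  have := finitary_sum (F.restrictSubtype F.E) (C.restrictSubtype C.E)
  unfold disjointSum
  infer_instance

lemma disjointSum_closure_eq (h : Disjoint F.E C.E) (X : Set α) :
    (F.disjointSum C h).closure X = F.closure X ∪ C.closure X := by
  have hF : Subtype.val '' (Sum.inl ⁻¹' (Function.Embedding.sumSet h ⁻¹' X)) = X ∩ F.E := by
    ext; simp
  have hC : Subtype.val '' (Sum.inr ⁻¹' (Function.Embedding.sumSet h ⁻¹' X)) = X ∩ C.E := by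
    ext; simp
  ext e
  simp only [disjointSum, mapEmbedding, map_closure_eq, restrictSubtype, Set.mem_image, Sum.exists,
    inl_mem_sum_closure_iff, inr_mem_sum_closure_iff, comap_closure_eq, hF, hC,
    restrict_ground_eq_self, closure_inter_ground, Set.mem_union, Set.mem_preimage]
  simpa using or_congr (and_iff_left_of_imp mem_ground_of_mem_closure)
    (and_iff_left_of_imp mem_ground_of_mem_closure)

lemma disjointSum_contract_indep (h : Disjoint F.E C.E) {B : Set α} (hB : B ⊆ F.E ∪ C.E)
    (hF : (F ／ X).Indep (B ∩ F.E)) (hC : (C ／ X).Indep (B ∩ C.E)) :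
    ((F.disjointSum C h) ／ X).Indep B := by
  rw [contract_indep_iff_forall_notMem_closure] at hF hC ⊢
  refine ⟨by rwa [disjointSum_ground_eq], fun b hb hcl ↦ ?_⟩
  have hclosure (M : Matroid α) : M.closure (X ∪ B \ {b}) ⊆ M.closure (X ∪ (B ∩ M.E) \ {b}) := by
    rw [← closure_inter_ground]
    refine M.closure_subset_closure ?_
    rintro x ⟨hx | hx, hxE⟩
    exacts [Or.inl hx, Or.inr ⟨⟨hx.1, hxE⟩, hx.2⟩]
  rw [disjointSum_closure_eq] at hcl
  rcases hcl with hcl | hcl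
  · exact hF.2 b ⟨hb, mem_ground_of_mem_closure hcl⟩ (hclosure F hcl)
  · exact hC.2 b ⟨hb, mem_ground_of_mem_closure hcl⟩ (hclosure C hcl)

lemma sum_disjointSum_eq (h : Disjoint F.E C.E) (G : Matroid β)
    (h' : Disjoint (F.sum G).E (C.map Sum.inl Sum.inl_injective.injOn).E) :
    (F.disjointSum C h).sum G =
      (F.sum G).disjointSum (C.map Sum.inl Sum.inl_injective.injOn) h' := by
  refine ext_closure fun X ↦ Set.ext ?_
  rw [disjointSum_closure_eq, map_closure_eq]
  rintro (e | e)
  · simp [inl_mem_sum_closure_iff, disjointSum_closure_eq]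
  · simp [inr_mem_sum_closure_iff]

end DirectSum

section Dual

variable {A I J K L : Set α}

lemma contract_compl_indep_of_subset_dual_closure (hA : A ⊆ M✶.closure K) (hKA : K ⊆ A)
    (hIA : I ⊆ A) (hIK : Disjoint I K) : (M ／ (M.E \ A)).Indep I := by
  have hAE : A ⊆ M✶.E := hA.trans (M✶.closure_subset_ground K)
  have hspan : (M✶ ↾ A).Spanning (A \ I) := by
    rw [restrict_spanning_iff Set.sdiff_subset hAE]
    exact hA.trans (M✶.closure_subset_closure (Set.subset_sdiff.2 ⟨hKA, hIK.symm⟩))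
  have hcoindep : (M✶ ↾ A).Coindep I := (coindep_iff_compl_spanning hIA).2 hspan
  rw [← M✶.delete_compl hAE] at hcoindep
  simpa [Coindep] using hcoindep

lemma subset_closure_of_dual_contract_indep (hL : (M✶ ／ A).Indep L)
    (hJL : M.E \ A ⊆ J ∪ L) : M.E \ A ⊆ M.closure J := by
  rw [← dual_delete] at hL
  have hspan := (show (M ＼ A).Coindep L from hL).compl_spanning
  have hcl := (spanning_iff_ground_subset_closure hspan.subset_ground).1 hspan
  rw [delete_closure_eq, delete_ground] at hcl
  refine hcl.trans (Set.sdiff_subset.trans (M.closure_subset_closure ?_))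
  rintro x ⟨⟨hx, hxL⟩, -⟩
  exact (hJL hx).resolve_right hxL

/-- `D` will be a closed set of the finitary matroid replacing `F ⊕ C`; a common independent set
there consists of `I ∪ J` in `M` and of `K ∪ L` in the dual of `C`. -/
lemma hasIntersection_disjointSum_of_dual {F C : Matroid α} {D : Set α} (h : Disjoint F.E C.E)
    (hE : M.E = F.E ∪ C.E) (hDE : D ⊆ M.E)
    (hI : I ⊆ M.E \ D ∧ M.E \ D ⊆ M.closure I) (hJ : J ⊆ D ∧ (M ／ (M.E \ D)).Indep J)
    (hF : (F ／ D).Indep (I ∩ F.E) ∧ D ∩ F.E ⊆ F.closure J)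
    (hK : K ⊆ C.E \ D ∧ C.E \ D ⊆ C✶.closure K) (hIK : Disjoint I K)
    (hL : (C✶ ／ (C.E \ D)).Indep L) (hJL : C.E ∩ D ⊆ J ∪ L) :
    HasIntersection M (F.disjointSum C h) := by
  refine ⟨M.E \ D, ⟨I, hI.1, hI.2, ?_⟩, J, ?_, ?_, ?_⟩
  · rw [disjointSum_ground_eq, ← hE, Set.sdiff_sdiff_cancel_left hDE]
    refine disjointSum_contract_indep h (hE ▸ hI.1.trans Set.sdiff_subset) hF.1 ?_
    have hIC := contract_compl_indep_of_subset_dual_closure (I := I ∩ C.E) hK.2 hK.1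
      (fun x hx ↦ ⟨hx.2, (hI.1 hx.1).2⟩) (hIK.mono_left Set.inter_subset_left)
    rwa [Set.sdiff_sdiff_right_self, Set.inter_comm, contract_inter_ground_eq] at hIC
  · rw [Set.sdiff_sdiff_cancel_left hDE]
    exact hJ.1
  · rw [Set.sdiff_sdiff_cancel_left hDE, disjointSum_closure_eq]
    have hDC := subset_closure_of_dual_contract_indep (J := J) hL
      (by rwa [Set.sdiff_sdiff_right_self])
    rw [Set.sdiff_sdiff_right_self] at hDC
    intro x hx
    rcases hE ▸ hDE hx with hxF | hxC
    exacts [Or.inl (hF.2 ⟨hx, hxF⟩), Or.inr (hDC ⟨hxC, hx⟩)]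
  · rw [Set.sdiff_sdiff_cancel_left hDE]
    exact hJ.2

end Dual

section Doubling

variable {F C : Matroid α} {e : α} {X : Set (α ⊕ α)}

lemma disjoint_map_inl_comap_freeOn (h : Disjoint F.E C.E) :
    Disjoint (F.map Sum.inl Sum.inl_injective.injOn).E
      ((freeOn C.E).comap (Sum.elim id id : α ⊕ α → α)).E := by
  simpa [Set.disjoint_left] using fun e he ↦ h.notMem_of_mem_left he

/-- The matroid obtained from `F ⊕ C` by forgetting the circuits of `C` and adding to every
`e ∈ C.E` a parallel copy `Sum.inr e`. -/
def doubling (F C : Matroid α) (h : Disjoint F.E C.E) : Matroid (α ⊕ α) :=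
  (F.map Sum.inl Sum.inl_injective.injOn).disjointSum
    ((freeOn C.E).comap (Sum.elim id id)) (disjoint_map_inl_comap_freeOn h)

lemma doubling_ground (h : Disjoint F.E C.E) :
    (doubling F C h).E = Sum.inl '' (F.E ∪ C.E) ∪ Sum.inr '' C.E := by
  ext (e | e) <;> simp [doubling]

lemma sum_dual_ground_eq_doubling_ground (h : Disjoint F.E C.E) (hE : M.E = F.E ∪ C.E) :
    (M.sum C✶).E = (doubling F C h).E := by
  rw [sum_ground, doubling_ground, hE, dual_ground]

lemma countable_doubling_ground (h : Disjoint F.E C.E) (hc : (F.E ∪ C.E).Countable) :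
    (doubling F C h).E.Countable := by
  rw [doubling_ground]
  exact (hc.image _).union ((hc.mono Set.subset_union_right).image _)

lemma finitary_doubling [F.Finitary] (h : Disjoint F.E C.E) : (doubling F C h).Finitary :=
  finitary_disjointSum _

lemma inl_mem_doubling_closure_iff (h : Disjoint F.E C.E) :
    Sum.inl e ∈ (doubling F C h).closure X ↔
      e ∈ F.closure (Sum.inl ⁻¹' X) ∨ e ∈ C.E ∧ (Sum.inl e ∈ X ∨ Sum.inr e ∈ X) := by
  simp [doubling, disjointSum_closure_eq, and_comm]

lemma inr_mem_doubling_closure_iff (h : Disjoint F.E C.E) :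
    Sum.inr e ∈ (doubling F C h).closure X ↔ e ∈ C.E ∧ (Sum.inl e ∈ X ∨ Sum.inr e ∈ X) := by
  simp [doubling, disjointSum_closure_eq, and_comm]

lemma doubling_contract_indep (h : Disjoint F.E C.E) {B : Set (α ⊕ α)}
    (hB : ((doubling F C h) ／ X).Indep B) :
    (F ／ (Sum.inl ⁻¹' X)).Indep (Sum.inl ⁻¹' B ∩ F.E) ∧
      Disjoint (Sum.inl ⁻¹' B) (Sum.inr ⁻¹' B) := by
  rw [contract_indep_iff_forall_notMem_closure] at hB
  refine ⟨contract_indep_iff_forall_notMem_closure.2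
    ⟨Set.inter_subset_right, fun b hb hcl ↦ hB.2 _ hb.1 ?_⟩,
    Set.disjoint_left.2 fun b hl hr ↦ hB.2 _ hl ?_⟩
  · refine (inl_mem_doubling_closure_iff h).2 (Or.inl (F.closure_subset_closure (fun x ↦ ?_) hcl))
    rintro (hx | ⟨hx, hxb⟩)
    exacts [Or.inl hx, Or.inr ⟨hx.1, fun heq ↦ hxb (Sum.inl_injective heq)⟩]
  · have hbC : b ∈ C.E := by simpa [doubling_ground] using hB.1 hr
    exact (inl_mem_doubling_closure_iff h).2
      (Or.inr ⟨hbC, Or.inr (Or.inr ⟨hr, Sum.inr_ne_inl⟩)⟩)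

lemma HasIntersection.of_sum_doubling (h : Disjoint F.E C.E) (hE : M.E = F.E ∪ C.E)
    (hint : HasIntersection (M.sum C✶) (doubling F C h)) :
    HasIntersection M (F.disjointSum C h) := by
  obtain ⟨D', I, J, hflat, hID, hJD, hI, hJ, hIN, hJM⟩ :=
    hint.exists_isFlat (sum_dual_ground_eq_doubling_ground h hE)
  set D : Set α := Sum.inl ⁻¹' D'
  have hparallel {e : α} (he : e ∈ C.E) : Sum.inl e ∈ D' ↔ Sum.inr e ∈ D' := by
    rw [← hflat.closure, inl_mem_doubling_closure_iff, inr_mem_doubling_closure_iff,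
      or_iff_right fun heF ↦ h.notMem_of_mem_right he (mem_ground_of_mem_closure heF)]
  have hAl : Sum.inl ⁻¹' ((M.sum C✶).E \ D') = M.E \ D := by ext; simp [D]
  have hAr : Sum.inr ⁻¹' ((M.sum C✶).E \ D') = C.E \ D := by
    ext e; simpa [D] using fun he ↦ (hparallel he).symm.not
  obtain ⟨hJ_M, hJ_C⟩ := sum_contract_indep hJM
  obtain ⟨hI_F, hI_disj⟩ := doubling_contract_indep h hIN
  rw [hAl] at hJ_M
  rw [hAr] at hJ_C
  refine hasIntersection_disjointSum_of_dual h hE ?_ ⟨?_, ?_⟩ ⟨?_, hJ_M⟩ ⟨hI_F, ?_⟩ ⟨?_, ?_⟩ hI_disj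
    hJ_C ?_
  · exact fun x hx ↦ by simpa [hE, doubling_ground] using hflat.subset_ground hx
  · exact hAl ▸ Set.preimage_mono hID
  · exact fun x hx ↦ inl_mem_sum_closure_iff.1 (hI (hAl.symm.subset hx))
  · exact Set.preimage_mono hJD
  · rintro x ⟨hxD, hxF⟩
    refine ((inl_mem_doubling_closure_iff h).1 (hJ hxD)).resolve_right fun hxC ↦ ?_
    exact h.notMem_of_mem_left hxF hxC.1
  · exact hAr ▸ Set.preimage_mono hID
  · exact fun x hx ↦ inr_mem_sum_closure_iff.1 (hI (hAr.symm.subset hx))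
  · rintro x ⟨hxC, hxD⟩
    exact ((inr_mem_doubling_closure_iff h).1 (hJ ((hparallel hxC).1 hxD))).2

end Doubling

lemma isFinitarySumCofinitary_sum {β : Type*} (hM : M.IsFinitarySumCofinitary) (G : Matroid β)
    [G.Finitary] : (M.sum G).IsFinitarySumCofinitary := by
  obtain ⟨F, C, h, hF, hC, rfl⟩ := hM
  have hdisj : Disjoint (F.sum G).E (C.map Sum.inl Sum.inl_injective.injOn).E := by
    rw [sum_ground, map_ground, Set.disjoint_union_left,
      Set.disjoint_image_iff Sum.inl_injective]
    exact ⟨h, Set.disjoint_image_inl_image_inr.symm⟩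
  have hCmap : (C✶.map (Sum.inl : α → α ⊕ β) Sum.inl_injective.injOn).Finitary :=
    have : C✶.Finitary := hC
    inferInstance
  exact ⟨_, _, hdisj, finitary_sum F G, by rwa [IsCofinitary, map_dual],
    sum_disjointSum_eq h G hdisj⟩

lemma hasIntersection_of_finitary_of_isFinitarySumCofinitary [M.Finitary]
    (hN : N.IsFinitarySumCofinitary) (hE : M.E = N.E) (hc : M.E.Countable) :
    HasIntersection M N := by
  obtain ⟨F, C, h, hF, hC, rfl⟩ := hN
  rw [disjointSum_ground_eq] at hE
  have : C✶.Finitary := hC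
  have := finitary_sum M C✶
  have := finitary_doubling h
  have hground := sum_dual_ground_eq_doubling_ground h hE
  exact HasIntersection.of_sum_doubling h hE
    (hasIntersection_of_finitary hground (hground ▸ countable_doubling_ground h (hE ▸ hc)))

lemma hasIntersection_of_isFinitarySumCofinitary (hM : M.IsFinitarySumCofinitary)
    (hN : N.IsFinitarySumCofinitary) (hE : M.E = N.E) (hc : M.E.Countable) :
    HasIntersection M N := by
  obtain ⟨F, C, h, hF, hC, rfl⟩ := hN
  rw [disjointSum_ground_eq] at hE
  have : C✶.Finitary := hC
  have := finitary_doubling h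
  have hground := sum_dual_ground_eq_doubling_ground h hE
  exact HasIntersection.of_sum_doubling h hE
    ((hasIntersection_of_finitary_of_isFinitarySumCofinitary (isFinitarySumCofinitary_sum hM C✶)
      hground.symm (countable_doubling_ground h (hE ▸ hc))).symm hground.symm)

end MatroidIntersection

theorem theorem1p2 {α : Type*} (E : Set α) (hE : E.Countable) (M N : Matroid α)
    (hME : M.E = E) (hNE : N.E = E)
    (hM : M.IsFinitarySumCofinitary) (hN : N.IsFinitarySumCofinitary) :
    ∃ I : Set α, M.Indep I ∧ N.Indep I ∧
      ∃ E_M E_N : Set α, E_M ∪ E_N = E ∧ Disjoint E_M E_N ∧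
        E_M ⊆ M.closure (I ∩ E_M) ∧ E_N ⊆ N.closure (I ∩ E_N) := by
  have h := MatroidIntersection.hasIntersection_of_isFinitarySumCofinitary hM hN
    (hME.trans hNE.symm) (hME.symm ▸ hE)
  rw [← hME]
  exact h.exists_common_indep (hME.trans hNE.symm)
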